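/- Let $R$ be a commutative ring with identity. An ideal $I$ of $R$ is called dense if $(0:_R I)=0$, and semi-regular if it contains a finitely generated dense ideal of $R$. Let $\mathcal{Q}$ be the set of finitely generated semi-regular ideals of $R$. For an ideal $I$ of $R$ put $I_q=\{x\in E_R(R)\mid Jx\subseteq I \text{ for some } J\in\mathcal{Q}\}$, where $E_R(R)$ is the injective envelope of the $R$-module $R$; call $I$ a $q$-ideal if $I_q\cap R=I$. A maximal $q$-ideal is a maximal element of the set of proper $q$-ideals, and the $q$-Krull dimension of $R$ is $$q\text{-}\dim(R)=\sup\{\operatorname{ht}\mathfrak{p}\mid \mathfrak{p}\text{ a maximal } q\text{-ideal of }R\}.$$ (For the zero ring, both the $q$-Krull dimension and the Krull dimension are taken to be $-\infty$.) The ring $R$ is called $\tau_q$-Noetherian if it satisfies the ascending chain condition on $q$-ideals. For a ring $S$, let $T(S)$ be its total quotient ring. Theorem. Let $R$ be a $\tau_q$-Noetherian ring, and let $R[x]$ be the polynomial ring in one variable over $R$. Then $$q\text{-}\dim(R)=q\text{-}\dim(R[x])=\dim(T(R[x])),$$ an equality of elements of $\{-\infty\}\cup\mathbb{N}\cup\{\infty\}$.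 -/

import Mathlib

universe u

namespace QOperation

section InjectiveEnvelope

/-- An injective envelope of the `R`-module `M`: an injective module `E` with an embedding of `M`
whose image is essential, i.e. meets every nonzero submodule of `E` nontrivially. -/
structure InjEnvelope (R : Type u) [CommRing R] (M : Type u) [AddCommGroup M] [Module R M] :
    Type (u + 1) where
  carrier : Type u
  [addCommGroup : AddCommGroup carrier]
  [module : Module R carrier]
  ι : M →ₗ[R] carrier
  ι_injective : Function.Injective ι
  essential : ∀ K : Submodule R carrier, K ⊓ LinearMap.range ι = ⊥ → K = ⊥
  injective : Module.Injective R carrier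

attribute [instance] InjEnvelope.addCommGroup InjEnvelope.module

theorem exists_injective_embedding (R : Type u) [CommRing R] (M : Type u) [AddCommGroup M]
    [Module R M] : ∃ (I : Type u) (_ : AddCommGroup I) (_ : Module R I) (f : M →ₗ[R] I),
      Function.Injective f ∧ Module.Injective R I := by
  obtain ⟨⟨J, hJ, f, hf⟩⟩ :=
    CategoryTheory.EnoughInjectives.presentation (C := ModuleCat.{u} R) (ModuleCat.of R M)
  exact ⟨J, inferInstance, inferInstance, f.hom, (ModuleCat.mono_iff_injective f).1 hf,
    @Module.injective_module_of_injective_object R J _ _ _ hJ⟩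

/-- Every module has an injective envelope. -/
theorem nonempty_injEnvelope (R : Type u) [CommRing R] (M : Type u) [AddCommGroup M]
    [Module R M] : Nonempty (InjEnvelope R M) := by
  obtain ⟨I, _, _, f, hf, hI⟩ := exists_injective_embedding R M
  -- `N` is a maximal essential extension of the image of `M` in `I`
  obtain ⟨N, hfN, hN⟩ := zorn_le_nonempty₀
    {N : Submodule R I | LinearMap.range f ≤ N ∧
      ∀ x ∈ N, x ≠ 0 → ∃ r : R, r • x ≠ 0 ∧ r • x ∈ LinearMap.range f}
    (by
      intro c hc hchain y hy
      refine ⟨sSup c, ⟨(hc hy).1.trans (le_sSup hy), ?_⟩, fun z hz => le_sSup hz⟩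
      intro x hx hx0
      obtain ⟨P, hP, hxP⟩ := (Submodule.mem_sSup_of_directed ⟨y, hy⟩ hchain.directedOn).1 hx
      exact (hc hP).2 x hxP hx0)
    (LinearMap.range f) ⟨le_rfl, fun x hx hx0 => ⟨1, by simpa using hx0, by simpa using hx⟩⟩
  -- `C` is maximal among the submodules that meet `N` trivially
  obtain ⟨C, -, hC⟩ := zorn_le_nonempty₀ {C : Submodule R I | ∀ n ∈ N, n ∈ C → n = 0}
    (by
      intro c hc hchain y hy
      refine ⟨sSup c, ?_, fun z hz => le_sSup hz⟩
      intro x hxN hx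
      obtain ⟨P, hP, hxP⟩ := (Submodule.mem_sSup_of_directed ⟨y, hy⟩ hchain.directedOn).1 hx
      exact hc hP x hxN hxP)
    ⊥ (by intro n _ h; simpa using h)
  have hg : Function.Injective (C.mkQ ∘ₗ N.subtype) := by
    rw [injective_iff_map_eq_zero]
    intro n hn
    have : (n : I) ∈ C := by simpa using hn
    exact Subtype.ext (hC.prop n n.2 this)
  obtain ⟨h, hh⟩ := hI.out (C.mkQ ∘ₗ N.subtype) hg N.subtype
  have hrange : LinearMap.range h ≤ N := by
    have hle : N ≤ LinearMap.range h := fun n hn => ⟨_, hh ⟨n, hn⟩⟩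
    refine hN.le_of_ge ⟨hfN.trans hle, ?_⟩ hle
    rintro _ ⟨z, rfl⟩ hy0
    obtain ⟨x, rfl⟩ := C.mkQ_surjective z
    have hxC : x ∉ C := fun hx => hy0 (by
      have : C.mkQ x = 0 := by simpa using hx
      rw [this, map_zero])
    have hnot : ¬ ∀ n ∈ N, n ∈ C ⊔ Submodule.span R {x} → n = 0 := by
      intro hcon
      have := hC.le_of_ge (y := C ⊔ Submodule.span R {x}) hcon le_sup_left
      exact hxC (this (le_sup_right (a := C) (Submodule.mem_span_singleton_self x)))
    push Not at hnot
    obtain ⟨n, hnN, hn, hn0⟩ := hnot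
    obtain ⟨c, hc, w, hw, rfl⟩ := Submodule.mem_sup.1 hn
    obtain ⟨r, rfl⟩ := Submodule.mem_span_singleton.1 hw
    have key : r • h (C.mkQ x) = c + r • x := by
      have h1 := hh ⟨_, hnN⟩
      have h2 : C.mkQ c = 0 := by simpa using hc
      simp only [LinearMap.comp_apply, Submodule.subtype_apply, map_add, h2, zero_add,
        map_smul] at h1
      exact h1
    obtain ⟨s, hs0, hs⟩ := hN.prop.2 _ hnN hn0
    refine ⟨s * r, ?_, ?_⟩
    · rwa [mul_smul, key]
    · rwa [mul_smul, key]
  let ρ : I →ₗ[R] N := LinearMap.codRestrict N (h ∘ₗ C.mkQ) fun x => hrange ⟨_, rfl⟩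
  have hρ : ∀ n : N, ρ n = n := fun n => Subtype.ext (hh n)
  refine ⟨{ carrier := N, ι := LinearMap.codRestrict N f fun x => hfN ⟨x, rfl⟩,
            ι_injective := ?_, essential := ?_, injective := ?_ }⟩
  · intro a b hab
    exact hf (congrArg Subtype.val hab)
  · intro K hK
    rw [eq_bot_iff]
    intro x hx
    by_contra hx0
    have hx0' : (x : I) ≠ 0 := fun h0 => hx0 (by simpa using h0)
    obtain ⟨r, hr0, m, hm⟩ := hN.prop.2 x x.2 hx0'
    have : r • x ∈ K ⊓ LinearMap.range (LinearMap.codRestrict N f fun x => hfN ⟨x, rfl⟩) :=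
      ⟨K.smul_mem r hx, m, Subtype.ext hm⟩
    rw [hK] at this
    exact hr0 (congrArg Subtype.val ((Submodule.mem_bot R).1 this))
  · refine ⟨fun X Y _ _ _ _ i hi g => ?_⟩
    obtain ⟨k, hk⟩ := hI.out i hi (N.subtype ∘ₗ g)
    exact ⟨ρ ∘ₗ k, fun x => by
      rw [LinearMap.comp_apply, hk]
      exact hρ (g x)⟩

/-- The injective envelope `E_R(M)` (unique up to isomorphism over `M`). -/
noncomputable def injEnvelope (R : Type u) [CommRing R] (M : Type u) [AddCommGroup M]
    [Module R M] : InjEnvelope R M :=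
  Classical.choice (nonempty_injEnvelope R M)

end InjectiveEnvelope

/-- `(0 :_R I) = 0`. -/
def IsDense {R : Type u} [CommRing R] (I : Ideal R) : Prop :=
  ∀ r : R, (∀ a ∈ I, a * r = 0) → r = 0

/-- An ideal with a finitely generated dense subideal. -/
def IsSemiregular {R : Type u} [CommRing R] (I : Ideal R) : Prop :=
  ∃ J : Ideal R, J ≤ I ∧ J.FG ∧ IsDense J

/-- The set `𝒬` of finitely generated semi-regular ideals. -/
def semiregularFG (R : Type u) [CommRing R] : Set (Ideal R) :=
  {J | J.FG ∧ IsSemiregular J}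

theorem IsDense.mul {R : Type u} [CommRing R] {I J : Ideal R} (hI : IsDense I)
    (hJ : IsDense J) : IsDense (I * J) := by
  intro r hr
  refine hJ r fun b hb => hI _ fun a ha => ?_
  rw [← mul_assoc]
  exact hr _ (Ideal.mul_mem_mul ha hb)

theorem mul_mem_semiregularFG {R : Type u} [CommRing R] {I J : Ideal R}
    (hI : I ∈ semiregularFG R) (hJ : J ∈ semiregularFG R) : I * J ∈ semiregularFG R := by
  obtain ⟨hI, I', hI', hIfg, hId⟩ := hI
  obtain ⟨hJ, J', hJ', hJfg, hJd⟩ := hJ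
  exact ⟨Submodule.FG.mul hI hJ, I' * J', Ideal.mul_mono hI' hJ', Submodule.FG.mul hIfg hJfg,
    hId.mul hJd⟩

theorem top_mem_semiregularFG (R : Type u) [CommRing R] : (⊤ : Ideal R) ∈ semiregularFG R := by
  have hfg : (⊤ : Ideal R).FG := ⟨{1}, by simp⟩
  exact ⟨hfg, ⊤, le_rfl, hfg, fun r hr => by simpa using hr 1 trivial⟩

/-- All `x ∈ E` with `J x ⊆ N` for some `J ∈ 𝒬`, for a submodule `N` of `E`. -/
def qClosure {R : Type u} [CommRing R] {E : Type u} [AddCommGroup E] [Module R E]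
    (N : Submodule R E) : Submodule R E where
  carrier := {x | ∃ J ∈ semiregularFG R, ∀ a ∈ J, a • x ∈ N}
  zero_mem' := ⟨⊤, top_mem_semiregularFG R, fun a _ => by
    rw [smul_zero]; exact Submodule.zero_mem _⟩
  add_mem' := fun {x y} hx hy => by
    obtain ⟨I, hI, hIx⟩ : ∃ J ∈ semiregularFG R, ∀ a ∈ J, a • x ∈ N := hx
    obtain ⟨J, hJ, hJy⟩ : ∃ J ∈ semiregularFG R, ∀ a ∈ J, a • y ∈ N := hy
    refine ⟨I * J, mul_mem_semiregularFG hI hJ, fun a ha => ?_⟩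
    rw [smul_add]
    exact N.add_mem (hIx a (Ideal.mul_le_left ha)) (hJy a (Ideal.mul_le_right ha))
  smul_mem' := fun r x hx => by
    obtain ⟨J, hJ, hJx⟩ : ∃ J ∈ semiregularFG R, ∀ a ∈ J, a • x ∈ N := hx
    refine ⟨J, hJ, fun a ha => ?_⟩
    rw [smul_comm]
    exact N.smul_mem r (hJx a ha)

/-- The Lucas envelope `N_q` of a submodule `N` of `M`, inside `E_R(M)`:
all `x ∈ E_R(M)` with `J x ⊆ N` for some `J ∈ 𝒬`. For `N = M` this is `M_q`. If `M` is
`𝒬`-torsion-free (as `M = R` is), such an `x` lies in every copy of `E_R(N)` inside `E_R(M)`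
that contains `N`, so it does not matter that `x` ranges over `E_R(M)` instead of `E_R(N)`. -/
noncomputable def lucasEnvelope (R : Type u) [CommRing R] {M : Type u} [AddCommGroup M]
    [Module R M] (N : Submodule R M) : Submodule R (injEnvelope R M).carrier :=
  qClosure (N.map (injEnvelope R M).ι)

/-- `I` is a `q`-ideal: `I_q ∩ R = I`. -/
def IsQIdeal {R : Type u} [CommRing R] (I : Ideal R) : Prop :=
  (lucasEnvelope R I).comap (injEnvelope R R).ι = I

/-- A maximal `q`-ideal: maximal among the proper `q`-ideals. -/
def IsMaximalQIdeal {R : Type u} [CommRing R] (I : Ideal R) : Prop :=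
  Maximal (fun J : Ideal R => IsQIdeal J ∧ J ≠ ⊤) I

/-- The `q`-Krull dimension: the supremum of the heights of the maximal `q`-ideals. It takes values
in `ℕ ∪ {-∞, +∞}`, with value `-∞` exactly for the zero ring, as the Krull dimension does. -/
noncomputable def qKrullDim (R : Type u) [CommRing R] : WithBot ℕ∞ :=
  ⨆ (p : Ideal R) (_ : IsMaximalQIdeal p), (p.height : WithBot ℕ∞)

/-- The ascending chain condition on `q`-ideals. -/
def IsTauQNoetherian (R : Type u) [CommRing R] : Prop :=
  ∀ I : ℕ → Ideal R, (∀ n, IsQIdeal (I n)) → (∀ n, I n ≤ I (n + 1)) →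
    ∃ n, ∀ m, n ≤ m → I m = I n

end QOperation

/-!
The maximal `q`-ideals of a ring are the ideals maximal among those that are not semi-regular, and
they are prime (`isMaximalQIdeal_iff`, `isPrime_of_maximal_not_isSemiregular`). So a `q`-Krull
dimension is the supremum of the heights of the non-semi-regular ideals.

By McCoy's theorem a polynomial is regular if and only if its content ideal is dense. Moreover
finitely many polynomials `f`, `g`, ... of an ideal can be merged into one, `f + X ^ N * g + ...`,
whose content is the sum of their contents. Two things follow.

* An ideal of `R[X]` is semi-regular if and only if it contains a regular element
  (`isSemiregular_polynomial_iff`). Hence the primes of `R[X]` that are not semi-regular are those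
  that survive in the total quotient ring, with the same heights, and
  `q-dim R[X] = dim T(R[X])` (`qKrullDim_eq_ringKrullDim_fractionRing`). This holds for every `R`.
* An ideal of `R[X]` that is not semi-regular lies in `p R[X]` for some maximal `q`-ideal `p` of `R`
  (`exists_le_map_C`), while `p R[X]` is itself not semi-regular. So `q-dim R[X]` is the supremum of
  the heights of the ideals `p R[X]`.

It remains to see that `p R[X]` has the same height as `p`. Every ideal of `R_p` contracts to a
`q`-ideal of `R`, so that the chain condition on `q`-ideals makes `R_p` Noetherian; over a
Noetherian ring the equality of heights is known, and heights can be computed after localizing.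
-/

namespace QOperation

open Polynomial nonZeroDivisors

/-! ### Semi-regular ideals and maximal `q`-ideals -/

section SemiregularIdeals

variable {R : Type u} [CommRing R] {I J p : Ideal R}

theorem IsDense.mono (h : I ≤ J) (hI : IsDense I) : IsDense J :=
  fun r hr => hI r fun a ha => hr a (h ha)

theorem IsSemiregular.mono (h : I ≤ J) (hI : IsSemiregular I) : IsSemiregular J := by
  obtain ⟨K, hK, hfg, hd⟩ := hI
  exact ⟨K, hK.trans h, hfg, hd⟩

theorem isSemiregular_top : IsSemiregular (⊤ : Ideal R) :=
  (top_mem_semiregularFG R).2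

theorem mem_semiregularFG_iff : J ∈ semiregularFG R ↔ J.FG ∧ IsDense J :=
  ⟨fun ⟨hfg, _, hle, _, hd⟩ => ⟨hfg, hd.mono hle⟩, fun ⟨hfg, hd⟩ => ⟨hfg, J, le_rfl, hfg, hd⟩⟩

/-- Membership of elements of `R` in `I_q` does not involve the injective envelope, because `R`
embeds in it. -/
theorem isQIdeal_iff :
    IsQIdeal I ↔ ∀ J : Ideal R, J.FG → IsDense J → ∀ r, (∀ a ∈ J, a * r ∈ I) → r ∈ I := by
  have key (r : R) : r ∈ (lucasEnvelope R I).comap (injEnvelope R R).ι ↔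
      ∃ J ∈ semiregularFG R, ∀ a ∈ J, a * r ∈ I := by
    change (∃ J ∈ semiregularFG R, ∀ a ∈ J, a • (injEnvelope R R).ι r ∈ _) ↔ _
    simp_rw [← map_smul, Submodule.mem_map, smul_eq_mul, (injEnvelope R R).ι_injective.eq_iff,
      exists_eq_right]
  constructor
  · intro h J hfg hd r hr
    rw [← h]
    exact (key r).2 ⟨J, mem_semiregularFG_iff.2 ⟨hfg, hd⟩, hr⟩
  · intro h
    ext r
    rw [key]
    refine ⟨fun ⟨J, hJ, hr⟩ => ?_,
      fun hr => ⟨⊤, top_mem_semiregularFG R, fun a _ => I.mul_mem_left a hr⟩⟩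
    obtain ⟨hfg, hd⟩ := mem_semiregularFG_iff.1 hJ
    exact h J hfg hd r hr

/-- If `J ≤ I` is finitely generated and dense, then `J * 1 ≤ I` puts `1` into the `q`-ideal `I`. -/
theorem IsQIdeal.not_isSemiregular (hI : IsQIdeal I) (htop : I ≠ ⊤) : ¬ IsSemiregular I := by
  rintro ⟨J, hJ, hfg, hd⟩
  refine htop ((Ideal.eq_top_iff_one I).2 (isQIdeal_iff.1 hI J hfg hd 1 fun a ha => ?_))
  simpa using hJ ha

/-- Finitely generated dense ideals are closed under products, so the argument for ideals maximal
among those disjoint from a multiplicative set applies. -/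
theorem isPrime_of_maximal_not_isSemiregular
    (hp : Maximal (fun J : Ideal R => ¬ IsSemiregular J) p) : p.IsPrime := by
  refine ⟨fun h => hp.prop (h ▸ isSemiregular_top), fun {a b} hab => ?_⟩
  by_contra! hcon
  obtain ⟨ha, hb⟩ := hcon
  have larger {c : R} (hc : c ∉ p) : IsSemiregular (p ⊔ Ideal.span {c}) := by
    by_contra h
    exact hc (hp.le_of_ge h le_sup_left
      (Ideal.mem_sup_right (Ideal.mem_span_singleton_self c)))
  obtain ⟨J, hJ, hJfg, hJd⟩ := larger ha
  obtain ⟨K, hK, hKfg, hKd⟩ := larger hb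
  refine hp.prop ⟨J * K, ?_, Submodule.FG.mul hJfg hKfg, hJd.mul hKd⟩
  refine (Ideal.mul_mono hJ hK).trans ?_
  rw [Ideal.sup_mul, Ideal.mul_sup (Ideal.span {a}), Ideal.span_singleton_mul_span_singleton]
  exact sup_le Ideal.mul_le_left (sup_le Ideal.mul_le_right
    ((Ideal.span_singleton_le_iff_mem p).2 hab))

/-- An ideal contracted from the localization at a prime ideal without finitely generated dense
subideals is a `q`-ideal: every finitely generated dense ideal contains an element that becomes
a unit. -/
theorem isQIdeal_comap_localization [p.IsPrime] (hp : ¬ IsSemiregular p)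
    (L : Ideal (Localization.AtPrime p)) :
    IsQIdeal (L.comap (algebraMap R (Localization.AtPrime p))) := by
  refine isQIdeal_iff.2 fun J hfg hd r hr => ?_
  obtain ⟨s, hsJ, hsp⟩ := SetLike.not_le_iff_exists.1 fun hJp => hp ⟨J, hJp, hfg, hd⟩
  have hs := hr s hsJ
  rw [Ideal.mem_comap, map_mul] at hs
  exact (L.unit_mul_mem_iff_mem
    (IsLocalization.map_units (Localization.AtPrime p) (⟨s, hsp⟩ : p.primeCompl))).1 hs

/-- If `J * r ≤ p` with `J` dense and finitely generated, then `J` has an element outside `p`. -/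
theorem isQIdeal_of_isPrime [hpr : p.IsPrime] (hp : ¬ IsSemiregular p) : IsQIdeal p := by
  refine isQIdeal_iff.2 fun J hfg hd r hr => ?_
  obtain ⟨s, hsJ, hsp⟩ := SetLike.not_le_iff_exists.1 fun hJp => hp ⟨J, hJp, hfg, hd⟩
  exact (hpr.mem_or_mem (hr s hsJ)).resolve_left hsp

/-- Zorn's lemma applies, because an ideal is semi-regular as soon as it contains a certain finite
set: the union of a chain of ideals that are not semi-regular is not semi-regular either. -/
theorem exists_le_maximal_not_isSemiregular (hI : ¬ IsSemiregular I) :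
    ∃ p, I ≤ p ∧ Maximal (fun J : Ideal R => ¬ IsSemiregular J) p := by
  refine zorn_le_nonempty₀ {J : Ideal R | ¬ IsSemiregular J} ?_ I hI
  intro c hc hchain y hy
  refine ⟨sSup c, ?_, fun z hz => le_sSup hz⟩
  rintro ⟨J, hJ, hfg, hd⟩
  obtain ⟨P, hP, hJP⟩ := (CompleteLattice.isCompactElement_iff_le_of_directed_sSup_le _ J).1
    ((Submodule.fg_iff_compact J).1 hfg) c ⟨y, hy⟩ hchain.directedOn hJ
  exact hc hP ⟨J, hJP, hfg, hd⟩

theorem isMaximalQIdeal_iff :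
    IsMaximalQIdeal p ↔ Maximal (fun J : Ideal R => ¬ IsSemiregular J) p := by
  have prop {m : Ideal R} (hm : Maximal (fun J : Ideal R => ¬ IsSemiregular J) m) :
      IsQIdeal m ∧ m ≠ ⊤ := by
    have := isPrime_of_maximal_not_isSemiregular hm
    exact ⟨isQIdeal_of_isPrime hm.prop, this.ne_top⟩
  constructor
  · intro hp
    obtain ⟨m, hpm, hm⟩ := exists_le_maximal_not_isSemiregular
      (hp.prop.1.not_isSemiregular hp.prop.2)
    rwa [le_antisymm hpm (hp.le_of_ge (prop hm) hpm)]
  · intro hp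
    exact ⟨prop hp, fun J hJ => hp.2 (hJ.1.not_isSemiregular hJ.2)⟩

theorem height_le_qKrullDim (hI : ¬ IsSemiregular I) : (I.height : WithBot ℕ∞) ≤ qKrullDim R := by
  obtain ⟨p, hIp, hp⟩ := exists_le_maximal_not_isSemiregular hI
  exact le_iSup₂_of_le p (isMaximalQIdeal_iff.2 hp)
    (WithBot.coe_le_coe.2 (Ideal.height_mono hIp))

theorem qKrullDim_le_iff {d : WithBot ℕ∞} : qKrullDim R ≤ d ↔
    ∀ p : Ideal R, Maximal (fun J : Ideal R => ¬ IsSemiregular J) p →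
      (p.height : WithBot ℕ∞) ≤ d := by
  simp only [qKrullDim, iSup_le_iff, isMaximalQIdeal_iff]

end SemiregularIdeals

/-! ### Rings in which semi-regular ideals contain regular elements -/

/-- Under the hypothesis, the primes that are not semi-regular are the contractions of the primes of
the total quotient ring. -/
theorem qKrullDim_eq_ringKrullDim_fractionRing {A : Type u} [CommRing A]
    (hA : ∀ I : Ideal A, IsSemiregular I ↔ ∃ f ∈ I, f ∈ A⁰) :
    qKrullDim A = ringKrullDim (FractionRing A) := by
  apply le_antisymm
  · refine qKrullDim_le_iff.2 fun p hp => ?_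
    have := isPrime_of_maximal_not_isSemiregular hp
    have hdisj : Disjoint (A⁰ : Set A) (p : Set A) := Set.disjoint_left.2 fun f hf hfp =>
      hp.prop ((hA p).2 ⟨f, hfp, hf⟩)
    rw [← IsLocalization.height_map_of_disjoint (S := FractionRing A) A⁰ p hdisj]
    exact Ideal.height_le_ringKrullDim_of_ne_top
      (IsLocalization.isPrime_of_isPrime_disjoint A⁰ (FractionRing A) p this hdisj).ne_top
  · rcases subsingleton_or_nontrivial (FractionRing A) with _ | _
    · exact ringKrullDim_eq_bot_of_subsingleton.trans_le bot_le
    refine (ringKrullDim_le_iff_isMaximal_height_le _).2 fun M hM => ?_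
    rw [← IsLocalization.height_under A⁰ M]
    refine height_le_qKrullDim fun h => ?_
    obtain ⟨f, hfM, hf⟩ := (hA _).1 h
    exact hM.ne_top (M.eq_top_of_isUnit_mem hfM
      (IsLocalization.map_units (FractionRing A) (⟨f, hf⟩ : A⁰)))

/-! ### Contents of polynomials -/

section Content

variable {R : Type u} [CommRing R]

/-- McCoy's theorem in terms of content ideals. -/
theorem isDense_contentIdeal_iff {f : R[X]} : IsDense f.contentIdeal ↔ f ∈ R[X]⁰ := by
  rw [Polynomial.mem_nonZeroDivisors_iff]
  refine forall_congr' fun r => imp_congr_left ⟨fun h => ?_, fun h a ha => ?_⟩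
  · ext n
    rw [coeff_smul, smul_eq_mul, mul_comm, h _ (f.coeff_mem_contentIdeal n), coeff_zero]
  · induction ha using Submodule.span_induction with
    | mem a ha =>
      obtain ⟨n, -, rfl⟩ := mem_coeffs_iff.1 ha
      rw [mul_comm, ← smul_eq_mul, ← coeff_smul, h, coeff_zero]
    | zero => exact zero_mul r
    | add a b _ _ ha hb => rw [add_mul, ha, hb, add_zero]
    | smul c a _ ha => rw [smul_eq_mul, mul_assoc, ha, mul_zero]

theorem contentIdeal_le_iff {f : R[X]} {I : Ideal R} :
    f.contentIdeal ≤ I ↔ f ∈ I.map (C : R →+* R[X]) := by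
  rw [Ideal.mem_map_C_iff]
  refine ⟨fun h n => h (f.coeff_mem_contentIdeal n), fun h => Ideal.span_le.2 fun a ha => ?_⟩
  obtain ⟨n, -, rfl⟩ := mem_coeffs_iff.1 ha
  exact h n

/-- For large `N` the coefficients of `f + g * X ^ N` are those of `f` followed by those of `g`, so
that its content contains both contents. -/
theorem directed_contentIdeal (Q : Ideal R[X]) :
    Directed (· ≤ ·) fun f : Q => (f : R[X]).contentIdeal := by
  rintro ⟨f, hf⟩ ⟨g, hg⟩
  set N := f.natDegree + 1
  refine ⟨⟨f + g * X ^ N, Q.add_mem hf (Q.mul_mem_right _ hg)⟩, ?_, ?_⟩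
  all_goals
    change contentIdeal _ ≤ contentIdeal _
    rw [contentIdeal_le_iff, Ideal.mem_map_C_iff]
    intro n
  · rcases lt_or_ge n N with hn | hn
    · have h := (f + g * X ^ N).coeff_mem_contentIdeal n
      rwa [coeff_add, coeff_mul_X_pow', if_neg hn.not_ge, add_zero] at h
    · rw [coeff_eq_zero_of_natDegree_lt hn]
      exact zero_mem _
  · have h := (f + g * X ^ N).coeff_mem_contentIdeal (n + N)
    rwa [coeff_add, coeff_mul_X_pow, coeff_eq_zero_of_natDegree_lt (by lia), zero_add] at h

/-- Some `h` in a finitely generated dense ideal has a content containing the contents of all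
generators. A constant killing this content kills the ideal, so the content is dense and `h` is
regular by McCoy's theorem. -/
theorem isSemiregular_polynomial_iff (Q : Ideal R[X]) :
    IsSemiregular Q ↔ ∃ f ∈ Q, f ∈ R[X]⁰ := by
  constructor
  · rintro ⟨F, hFQ, ⟨s, rfl⟩, hd⟩
    classical
    obtain ⟨⟨h, hhF⟩, hh⟩ := (directed_contentIdeal (Ideal.span (s : Set R[X]))).finset_le
      (s.subtype (· ∈ Ideal.span (s : Set R[X])))
    have hle : Ideal.span (s : Set R[X]) ≤ h.contentIdeal.map C := Ideal.span_le.2 fun f hf =>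
      contentIdeal_le_iff.1 (hh ⟨f, Ideal.subset_span hf⟩ (Finset.mem_subtype.2 hf))
    refine ⟨h, hFQ hhF, isDense_contentIdeal_iff.1 fun r hr => C_eq_zero.1 (hd _ fun a ha => ?_)⟩
    ext n
    rw [coeff_mul_C, coeff_zero]
    exact hr _ (Ideal.mem_map_C_iff.1 (hle ha) n)
  · rintro ⟨f, hfQ, hf⟩
    refine ⟨Ideal.span {f}, by simpa [Ideal.span_le] using hfQ, ⟨{f}, by simp⟩, fun r hr => ?_⟩
    exact hf.1 r (hr f (Ideal.mem_span_singleton_self f))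

theorem IsSemiregular.of_map_C {I : Ideal R} (h : IsSemiregular (I.map (C : R →+* R[X]))) :
    IsSemiregular I := by
  obtain ⟨f, hfI, hf⟩ := (isSemiregular_polynomial_iff _).1 h
  exact ⟨f.contentIdeal, contentIdeal_le_iff.2 hfI, f.contentIdeal_FG,
    isDense_contentIdeal_iff.2 hf⟩

/-- The ideal generated by the contents of the elements of `Q` is a directed union of these
contents. A finitely generated dense subideal of it would lie in the content of a single element
of `Q`, which would then be regular. -/
theorem exists_le_map_C {Q : Ideal R[X]} (hQ : ¬ IsSemiregular Q) :
    ∃ p : Ideal R, Q ≤ p.map C ∧ Maximal (fun J : Ideal R => ¬ IsSemiregular J) p := by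
  have hc : ¬ IsSemiregular (⨆ f : Q, (f : R[X]).contentIdeal) := by
    rintro ⟨J, hJ, hfg, hd⟩
    obtain ⟨_, ⟨f, rfl⟩, hf⟩ := (Submodule.fg_iff_compact J).1 hfg _ _ (Set.range_nonempty _)
      (directed_contentIdeal Q).directedOn_range isLUB_iSup hJ
    exact hQ ((isSemiregular_polynomial_iff Q).2
      ⟨f, f.2, isDense_contentIdeal_iff.1 (hd.mono hf)⟩)
  obtain ⟨p, hle, hp⟩ := exists_le_maximal_not_isSemiregular hc
  exact ⟨p, fun f hf => contentIdeal_le_iff.1 ((le_iSup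
    (fun f : Q => (f : R[X]).contentIdeal) ⟨f, hf⟩).trans hle), hp⟩

end Content

/-! ### Heights of extended primes -/

section Height

variable {R : Type u} [CommRing R]

theorem IsTauQNoetherian.isNoetherianRing_localization (hR : IsTauQNoetherian R) {p : Ideal R}
    [p.IsPrime] (hp : ¬ IsSemiregular p) : IsNoetherianRing (Localization.AtPrime p) := by
  refine monotone_stabilizes_iff_noetherian.1
    fun (f : ℕ →o Ideal (Localization.AtPrime p)) => ?_
  obtain ⟨n, hn⟩ := hR (fun k => (f k).comap (algebraMap R (Localization.AtPrime p)))
    (fun k => isQIdeal_comap_localization hp (f k))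
    (fun k => Ideal.comap_mono (f.monotone k.le_succ))
  refine ⟨n, fun m hm => ?_⟩
  have h := congrArg (Ideal.map (algebraMap R (Localization.AtPrime p))) (hn m hm)
  simpa only [IsLocalization.map_under p.primeCompl] using h.symm

attribute [local instance] Polynomial.algebra Polynomial.isLocalization in
/-- `Polynomial.height_map_C` for the maximal ideal of the localization at `p`, transferred along
`R[X] → (Localization.AtPrime p)[X]`, which is a localization too. -/
theorem height_map_C_of_isNoetherianRing_localization (p : Ideal R) [p.IsPrime]
    [IsNoetherianRing (Localization.AtPrime p)] :
    (p.map (C : R →+* R[X])).height = p.height := by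
  have hdisj : Disjoint (p.primeCompl.map (C : R →+* R[X]) : Set R[X])
      (p.map (C : R →+* R[X]) : Set R[X]) := by
    rw [Set.disjoint_left]
    rintro _ ⟨b, hb, rfl⟩ hbp
    refine hb ?_
    simpa using Ideal.mem_map_C_iff.1 hbp 0
  have hpx : (p.map (C : R →+* R[X])).IsPrime := Ideal.isPrime_map_C_of_isPrime
  rw [← IsLocalization.height_map_of_disjoint (S := (Localization.AtPrime p)[X])
      (p.primeCompl.map (C : R →+* R[X])) _ hdisj,
    ← IsLocalization.height_map_of_disjoint (S := Localization.AtPrime p) p.primeCompl p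
      (Set.disjoint_left.2 fun _ h h' => h h'),
    Localization.AtPrime.map_eq_maximalIdeal,
    ← Polynomial.height_map_C (IsLocalRing.maximalIdeal _),
    ← Localization.AtPrime.map_eq_maximalIdeal, Ideal.map_map, Ideal.map_map]
  congr 2
  ext x : 1
  simp

end Height

end QOperation

theorem mainTheorem3 {R : Type u} [CommRing R] (hR : QOperation.IsTauQNoetherian R) :
    QOperation.qKrullDim R = QOperation.qKrullDim (Polynomial R) ∧
      QOperation.qKrullDim (Polynomial R) =
        ringKrullDim (FractionRing (Polynomial R)) := by
  open QOperation in
  refine ⟨?_, qKrullDim_eq_ringKrullDim_fractionRing isSemiregular_polynomial_iff⟩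
  have height_eq {p : Ideal R} (hp : Maximal (fun J : Ideal R => ¬ IsSemiregular J) p) :
      (p.map (Polynomial.C : R →+* Polynomial R)).height = p.height := by
    have := isPrime_of_maximal_not_isSemiregular hp
    have := hR.isNoetherianRing_localization hp.prop
    exact height_map_C_of_isNoetherianRing_localization p
  apply le_antisymm
  · refine qKrullDim_le_iff.2 fun p hp => ?_
    rw [← height_eq hp]
    exact height_le_qKrullDim fun h => hp.prop h.of_map_C
  · refine qKrullDim_le_iff.2 fun Q hQ => ?_
    obtain ⟨p, hQp, hp⟩ := exists_le_map_C hQ.prop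
    calc (Q.height : WithBot ℕ∞) ≤ (p.map Polynomial.C).height :=
          WithBot.coe_le_coe.2 (Ideal.height_mono hQp)
      _ = p.height := congrArg _ (height_eq hp)
      _ ≤ qKrullDim R := height_le_qKrullDim hp.prop
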